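/- Throughout, rings are associative with $1$ and modules are unital right modules unless said otherwise. Let $R$ be a semilocal ring (i.e. $R/J(R)$ is semisimple Artinian, where $J(R)$ is the Jacobson radical) that is right semihereditary (i.e. every finitely generated right ideal of $R$ is projective). Then the following statements are equivalent. 1. $R$ is right max-QF, i.e. every injective right $R$-module is max-projective. Here a right $R$-module $M$ is max-projective if for each maximal right ideal $I$ of $R$, each homomorphism $M\to R/I$ factors through the canonical projection $R\to R/I$. 2. $R\cong S\times T$ as rings, where $S$ is a semisimple Artinian ring and $T$ is a right small ring (either factor may be the zero ring). Here a module is small if it is isomorphic to a small submodule of some module (equivalently, if it is small in its injective hull), where a submodule $N$ of $L$ is small if $N+X\neq L$ for each proper submodule $X$ of $L$; and $T$ is right small if the right module $T_T$ is small. 3. Every simple injective right $R$-module is projective. 4. Every singular injective right $R$-module is max-projective. Here $M$ is singular if each $m\in M$ satisfies $mI=0$ for some essential right ideal $I$ of $R$. 5. The dual Goldie torsion theory of right $R$-modules splits, i.e. in every right $R$-module the torsion submodule is a direct summand. Here the dual Goldie torsion theory is the torsion theory generated by the small modules: $F$ is torsion-free if $\operatorname{Hom}_R(C,F)=0$ for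 all small modules $C$, a module $M$ is torsion if $\operatorname{Hom}_R(M,F)=0$ for all torsion-free $F$, and the torsion submodule of a module is the sum of its torsion submodules. -/

import Mathlib

universe u

namespace MaxQF

/- Right modules over `R` are modules over `Rᵐᵒᵖ`; in particular `R` itself is the right module
`R_R` when it is viewed as an `Rᵐᵒᵖ`-module, and `Submodule Rᵐᵒᵖ R` is the type of right ideals. -/

section Modules

variable (A : Type u) [Ring A]

/-- `N` is a small (superfluous) submodule of `M`: `N + X ≠ M` for each proper submodule `X`. -/
def IsSmallSubmodule {M : Type u} [AddCommGroup M] [Module A M] (N : Submodule A M) : Prop :=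
  ∀ X : Submodule A M, N ⊔ X = ⊤ → X = ⊤

/-- `N` is an essential submodule of `M`. -/
def IsEssentialSubmodule {M : Type u} [AddCommGroup M] [Module A M] (N : Submodule A M) : Prop :=
  ∀ X : Submodule A M, N ⊓ X = ⊥ → X = ⊥

/-- `M` is a small module: it is (up to isomorphism) a small submodule of some module.
(Equivalently, `M` is a small submodule of its injective hull.) -/
def IsSmallModule (M : Type u) [AddCommGroup M] [Module A M] : Prop :=
  ∃ (L : Type u) (_ : AddCommGroup L) (_ : Module A L) (i : M →ₗ[A] L),
    Function.Injective i ∧ IsSmallSubmodule A (LinearMap.range i)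

/-- The torsion-free class of the dual Goldie torsion theory, the torsion theory generated by the
class of small modules: the modules that receive only zero homomorphisms from small modules. -/
def IsDualGoldieTorsionFree (M : Type u) [AddCommGroup M] [Module A M] : Prop :=
  ∀ (C : Type u) [AddCommGroup C] [Module A C], IsSmallModule A C → ∀ f : C →ₗ[A] M, f = 0

/-- The torsion class of the dual Goldie torsion theory: the modules that have only zero
homomorphisms into torsion-free modules. -/
def IsDualGoldieTorsion (M : Type u) [AddCommGroup M] [Module A M] : Prop :=
  ∀ (N : Type u) [AddCommGroup N] [Module A N],
    IsDualGoldieTorsionFree A N → ∀ f : M →ₗ[A] N, f = 0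

/-- The torsion submodule of `M`: the sum of all torsion submodules of `M`. -/
def dualGoldieTorsionSubmodule (M : Type u) [AddCommGroup M] [Module A M] : Submodule A M :=
  sSup {N : Submodule A M | IsDualGoldieTorsion A N}

end Modules

section Rings

variable (R : Type u) [Ring R]

/-- `R` is semilocal: `R / J(R)` is semisimple Artinian. -/
def IsSemilocal : Prop :=
  IsSemisimpleRing (R ⧸ Ring.jacobson R)

/-- `R` is right semihereditary: all finitely generated right ideals are projective. -/
def IsRightSemihereditary : Prop :=
  ∀ I : Submodule Rᵐᵒᵖ R, I.FG → Module.Projective Rᵐᵒᵖ I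

/-- The right `R`-module `M` is max-projective: for each maximal right ideal `I`, each homomorphism
`M → R / I` factors through the canonical projection `R → R / I`. -/
def IsMaxProjective (M : Type u) [AddCommGroup M] [Module Rᵐᵒᵖ M] : Prop :=
  ∀ I : Submodule Rᵐᵒᵖ R, IsCoatom I →
    ∀ f : M →ₗ[Rᵐᵒᵖ] R ⧸ I, ∃ g : M →ₗ[Rᵐᵒᵖ] R, I.mkQ ∘ₗ g = f

/-- The right `R`-module `M` is singular: each `m ∈ M` satisfies `m I = 0` for some essential
right ideal `I`. -/
def IsSingular (M : Type u) [AddCommGroup M] [Module Rᵐᵒᵖ M] : Prop :=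
  ∀ m : M, ∃ I : Submodule Rᵐᵒᵖ R,
    IsEssentialSubmodule Rᵐᵒᵖ I ∧ ∀ r ∈ I, MulOpposite.op r • m = 0

/-- `R` is right max-QF: every injective right `R`-module is max-projective. -/
def IsRightMaxQF : Prop :=
  ∀ (E : Type u) [AddCommGroup E] [Module Rᵐᵒᵖ E],
    Module.Injective Rᵐᵒᵖ E → IsMaxProjective R E

/-- `R` is a right small ring: `R_R` is a small module. -/
def IsRightSmall : Prop :=
  IsSmallModule Rᵐᵒᵖ R

/-- The dual Goldie torsion theory of right `R`-modules splits: the torsion submodule of each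
right `R`-module is a direct summand. -/
def DualGoldieSplits : Prop :=
  ∀ (M : Type u) [AddCommGroup M] [Module Rᵐᵒᵖ M],
    ∃ K : Submodule Rᵐᵒᵖ M, IsCompl (dualGoldieTorsionSubmodule Rᵐᵒᵖ M) K

end Rings

end MaxQF

/-!
Right `R`-modules are treated as left modules over `A = Rᵐᵒᵖ`, a left semihereditary ring with
`A / J(A)` semisimple.

The semihereditary hypothesis enters through one fact,
`injective_of_surjective_of_isSimpleModule`: a simple quotient of an injective module is injective.
Hence a nonzero homomorphism from an injective module to a simple module exhibits the latter as
injective, and max-projectivity of injective modules follows from projectivity of the simple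
injective ones. Conversely, a simple max-projective module is projective, and a simple module is
singular or projective; this settles the equivalence of the max-QF condition, its singular version
and the projectivity of simple injective modules.

Suppose that simple injective modules are projective, and let `N` be their common annihilator. Then
`A / N` is semisimple, and as its simple submodules are injective, hence projective, it is both
injective and projective, which forces `N = A f` for a central idempotent `f`. If `i : A → E` is an embedding
in an injective module and `i N` were not superfluous in `E`, some nonzero simple quotient of `E`
would be an image of `N = N f`; but that quotient is injective, hence killed by `f`. So `A` is the
product of a semisimple ring and a ring that is small as a module
(`isSemisimpleBySmall_of_simple_injective_projective`).

Given such a decomposition, the torsion-free modules of the dual Goldie theory are exactly the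
modules killed by `f`, because these are injective and a surjection from a small module to an
injective module vanishes. Hence the torsion submodule of `M` is the summand `f M`
(`exists_isCompl_dualGoldieTorsionSubmodule`). If, finally, the torsion theory splits, then the
torsion submodule of `A` contains the superfluous ideal `J(A)`, so its complement `K` is semisimple
and projective; a simple injective module is torsion-free, hence a quotient of `K`, hence projective
(`projective_of_dualGoldie_splits`).
-/

namespace MaxQF

section LeftModules

variable {A : Type u} [Ring A]

/-! ### Small submodules and small modules -/

theorem IsSmallSubmodule.map {L L' : Type u} [AddCommGroup L] [Module A L] [AddCommGroup L']
    [Module A L'] {N : Submodule A L} (hN : IsSmallSubmodule A N) (p : L →ₗ[A] L') :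
    IsSmallSubmodule A (N.map p) := by
  intro X hX
  have h : N ⊔ X.comap p = ⊤ := by
    rw [eq_top_iff]
    intro l _
    have hl : p l ∈ N.map p ⊔ X := hX ▸ Submodule.mem_top
    obtain ⟨_, ⟨n, hn, rfl⟩, x, hx, hl⟩ := Submodule.mem_sup.mp hl
    refine Submodule.mem_sup.mpr ⟨n, hn, l - n, ?_, by abel⟩
    rw [Submodule.mem_comap, map_sub, ← hl, add_sub_cancel_left]
    exact hx
  have h' := hN _ h
  rw [eq_top_iff, ← hX, sup_le_iff]
  refine ⟨?_, le_rfl⟩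
  rintro _ ⟨n, -, rfl⟩
  exact (h'.ge Submodule.mem_top : n ∈ X.comap p)

theorem IsSmallSubmodule.isSmallModule {L : Type u} [AddCommGroup L] [Module A L]
    {N : Submodule A L} (hN : IsSmallSubmodule A N) : IsSmallModule A N :=
  ⟨L, _, _, N.subtype, N.injective_subtype, by rwa [Submodule.range_subtype]⟩

/-- An injective image of a small module is zero: extend the map to the ambient module in which
the small module is superfluous; the kernel of the extension is a supplement. -/
theorem IsSmallModule.eq_zero_of_surjective {C U : Type u} [AddCommGroup C] [Module A C]
    [AddCommGroup U] [Module A U] (hC : IsSmallModule A C) (hU : Module.Injective A U)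
    {g : C →ₗ[A] U} (hg : Function.Surjective g) : g = 0 := by
  obtain ⟨L, _, _, i, hi, hs⟩ := hC
  obtain ⟨h, hh⟩ := hU.out i hi g
  have htop : LinearMap.range i ⊔ LinearMap.ker h = ⊤ := by
    rw [eq_top_iff]
    intro l _
    obtain ⟨c, hc⟩ := hg (h l)
    refine Submodule.mem_sup.mpr ⟨i c, ⟨c, rfl⟩, l - i c, ?_, by abel⟩
    rw [LinearMap.mem_ker, map_sub, hh, hc, sub_self]
  have hk := hs _ htop
  ext c
  rw [← hh]
  exact (hk.ge Submodule.mem_top : i c ∈ LinearMap.ker h)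

theorem IsSmallModule.eq_zero_of_isSimpleModule {C U : Type u} [AddCommGroup C] [Module A C]
    [AddCommGroup U] [Module A U] (hC : IsSmallModule A C) [IsSimpleModule A U]
    (hU : Module.Injective A U) (g : C →ₗ[A] U) : g = 0 := by
  by_contra hg
  exact hg (hC.eq_zero_of_surjective hU (LinearMap.surjective_of_ne_zero hg))

/-- Nakayama's lemma for the ring itself: the Jacobson radical is superfluous. -/
theorem isSmallSubmodule_jacobson : IsSmallSubmodule A (Ring.jacobson A) := by
  intro X hX
  by_contra hne
  obtain ⟨M, hM, hXM⟩ := Ideal.exists_le_maximal X hne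
  exact hM.ne_top (top_le_iff.mp (hX ▸ sup_le (Ring.jacobson_le_of_isMaximal M) hXM))

/-! ### Simple quotients of injective modules -/

theorem exists_injective_embedding (M : Type u) [AddCommGroup M] [Module A M] :
    ∃ (E : Type u) (_ : AddCommGroup E) (_ : Module A E) (i : M →ₗ[A] E),
      Module.Injective A E ∧ Function.Injective i := by
  obtain ⟨⟨J, hJ, f, hf⟩⟩ := CategoryTheory.EnoughInjectives.presentation (ModuleCat.of A M)
  exact ⟨J, _, _, f.hom,
    Module.injective_module_of_injective_object (inj := hJ), (ModuleCat.mono_iff_injective f).mp hf⟩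

/-- Let `A` be left semihereditary with `A / J(A)` semisimple. A homomorphism from a finitely
generated left ideal to a quotient `V` of an injective module extends to `A`, since the ideal is
projective. When `V` is simple, so that `J(A)` kills it, an arbitrary left ideal `I` may be replaced
in Baer's criterion by a finitely generated one with the same image in the Noetherian module
`A / J(A)`. -/
theorem injective_of_surjective_of_isSimpleModule
    [IsSemisimpleModule A (A ⧸ Ring.jacobson A)]
    (hsh : ∀ I : Ideal A, I.FG → Module.Projective A I)
    {E V : Type u} [AddCommGroup E] [Module A E] [AddCommGroup V] [Module A V]
    (hE : Module.Injective A E) [IsSimpleModule A V] (q : E →ₗ[A] V)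
    (hq : Function.Surjective q) : Module.Injective A V := by
  have hfg : ∀ I : Ideal A, I.FG → ∀ g : I →ₗ[A] V, ∃ v : V, ∀ i : I, g i = (i : A) • v := by
    intro I hI g
    have := hsh I hI
    obtain ⟨g', hg'⟩ := Module.projective_lifting_property q g hq
    obtain ⟨h, hh⟩ := hE.out I.subtype I.injective_subtype g'
    refine ⟨q (h 1), fun i ↦ ?_⟩
    rw [← map_smul, ← map_smul, smul_eq_mul, mul_one]
    exact (LinearMap.congr_fun hg' i).symm.trans (congrArg q (hh i).symm)
  apply Module.Baer.injective
  intro I g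
  -- a finitely generated left ideal `I' ≤ I` with `I' + J(A) = I + J(A)`
  obtain ⟨I', hI'I, hI'fg, hI'map⟩ : ∃ I' : Ideal A, I' ≤ I ∧ I'.FG ∧
      Submodule.map (Ring.jacobson A).mkQ I' = Submodule.map (Ring.jacobson A).mkQ I := by
    classical
    obtain ⟨t, ht⟩ := IsNoetherian.noetherian (Submodule.map (Ring.jacobson A).mkQ I)
    obtain ⟨s, hs, rfl⟩ := Finset.subset_set_image_iff.mp
      (show (t : Set (A ⧸ Ring.jacobson A)) ⊆ (Ring.jacobson A).mkQ '' I from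
        fun x hx ↦ ht.le (Submodule.subset_span hx))
    exact ⟨Submodule.span A s, Submodule.span_le.mpr hs, ⟨s, rfl⟩, by
      rw [Submodule.map_span, ← ht, Finset.coe_image]⟩
  obtain ⟨v, hv⟩ := hfg I' hI'fg (g ∘ₗ Submodule.inclusion hI'I)
  refine ⟨LinearMap.toSpanSingleton A V v, fun i hi ↦ ?_⟩
  have hle : I' ⊔ Ideal.span {i} ≤ I := sup_le hI'I ((Ideal.span_singleton_le_iff_mem I).mpr hi)
  obtain ⟨w, hw⟩ := hfg (I' ⊔ Ideal.span {i})
    (Submodule.FG.sup hI'fg (Submodule.fg_span_singleton i)) (g ∘ₗ Submodule.inclusion hle)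
  have hiw : g ⟨i, hi⟩ = i • w :=
    hw ⟨i, Submodule.mem_sup_right (Ideal.mem_span_singleton_self i)⟩
  have hvw : ∀ a ∈ I', a • v = a • w := fun a ha ↦
    (hv ⟨a, ha⟩).symm.trans (hw ⟨a, Submodule.mem_sup_left ha⟩)
  -- `v - w` is killed by `I'` and by `J(A)`, hence by `i`
  have hi' : (Ring.jacobson A).mkQ i ∈ Submodule.map (Ring.jacobson A).mkQ I' :=
    hI'map ▸ Submodule.mem_map_of_mem hi
  obtain ⟨a, ha, hai⟩ := hi'
  have hJ : i - a ∈ Ring.jacobson A := by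
    rw [← Submodule.Quotient.eq]; exact hai.symm
  have hJV := IsSemisimpleModule.jacobson_le_annihilator A V hJ
  have hz := Module.mem_annihilator.mp hJV (v - w)
  rw [sub_smul, smul_sub, smul_sub, hvw a ha, sub_self, sub_zero, sub_eq_zero] at hz
  rw [hiw, ← hz]
  rfl

/-! ### Projectivity and injectivity of semisimple modules -/

/-- A simple module that is not killed by a semisimple left ideal is a direct summand of that
ideal, and in fact of the ring. -/
theorem projective_of_semisimple_ideal (K : Ideal A) [IsSemisimpleModule A K] {U : Type u}
    [AddCommGroup U] [Module A U] [IsSimpleModule A U] {k : A} (hk : k ∈ K) {u : U}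
    (hku : k • u ≠ 0) : Module.Projective A U := by
  let p : A →ₗ[A] U := LinearMap.toSpanSingleton A U u
  have hp : Function.Surjective (p ∘ₗ K.subtype) :=
    LinearMap.surjective_of_ne_zero fun h ↦ hku (LinearMap.congr_fun h ⟨k, hk⟩)
  obtain ⟨s, hs⟩ := IsSemisimpleModule.lifting_property (p ∘ₗ K.subtype) hp LinearMap.id
  exact Module.Projective.of_split (K.subtype ∘ₗ s) p hs

theorem injective_of_simple_submodules {M : Type u} [AddCommGroup M] [Module A M]
    [IsSemisimpleModule A M] [Module.Finite A M]
    (h : ∀ W : Submodule A M, IsSimpleModule A W → Module.Injective A W) :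
    Module.Injective A M := by
  obtain ⟨n, S, e, hS⟩ := IsSemisimpleModule.exists_linearEquiv_fin_dfinsupp A M
  have := fun i ↦ h (S i) (hS i)
  have e' := e ≪≫ₗ DFinsupp.linearEquivFunOnFintype (R := A) (M := fun i ↦ S i)
  exact (Module.Baer.of_equiv e'.symm (Module.Baer.of_injective inferInstance)).injective

theorem projective_of_simple_submodules {M : Type u} [AddCommGroup M] [Module A M]
    [IsSemisimpleModule A M] [Module.Finite A M]
    (h : ∀ W : Submodule A M, IsSimpleModule A W → Module.Projective A W) :
    Module.Projective A M := by
  obtain ⟨n, S, e, hS⟩ := IsSemisimpleModule.exists_linearEquiv_fin_dfinsupp A M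
  have := fun i ↦ h (S i) (hS i)
  exact Module.Projective.of_equiv e.symm

/-! ### The annihilator of the simple injective modules -/

variable (A) in
/-- The left ideal (in fact a two-sided one) of all elements that annihilate each simple injective
module. -/
def simpleInjectiveAnnihilator : Ideal A where
  carrier := {a | ∀ (U : Type u) [AddCommGroup U] [Module A U],
    IsSimpleModule A U → Module.Injective A U → ∀ u : U, a • u = 0}
  add_mem' ha hb U _ _ hs hi u := by rw [add_smul, ha U hs hi, hb U hs hi, add_zero]
  zero_mem' U _ _ _ _ u := zero_smul A u
  smul_mem' c a ha U _ _ hs hi u := by rw [smul_eq_mul, mul_smul, ha U hs hi, smul_zero]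

theorem simpleInjectiveAnnihilator_mul_mem {a : A} (ha : a ∈ simpleInjectiveAnnihilator A)
    (b : A) : a * b ∈ simpleInjectiveAnnihilator A := by
  intro U _ _ hs hi u
  rw [mul_smul]
  exact ha U hs hi (b • u)

theorem jacobson_le_simpleInjectiveAnnihilator :
    Ring.jacobson A ≤ simpleInjectiveAnnihilator A := by
  intro a ha U _ _ hs hi u
  exact Module.mem_annihilator.mp (IsSemisimpleModule.jacobson_le_annihilator A U ha) u

theorem isSemisimpleModule_quotient_simpleInjectiveAnnihilator
    [IsSemisimpleModule A (A ⧸ Ring.jacobson A)] :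
    IsSemisimpleModule A (A ⧸ simpleInjectiveAnnihilator A) :=
  IsSemisimpleModule.of_surjective
    (Submodule.factor jacobson_le_simpleInjectiveAnnihilator)
    (Submodule.factor_surjective jacobson_le_simpleInjectiveAnnihilator)

/-- A simple module `U` killed by the annihilator `N` of the simple injective modules embeds in the
semisimple module `A / N`, which is separated by homomorphisms to simple injective modules; so `U`
is isomorphic to one of them. -/
theorem injective_of_simpleInjectiveAnnihilator_smul
    [IsSemisimpleModule A (A ⧸ Ring.jacobson A)] {U : Type u} [AddCommGroup U] [Module A U]
    [IsSimpleModule A U] (hU : ∀ a ∈ simpleInjectiveAnnihilator A, ∀ u : U, a • u = 0) :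
    Module.Injective A U := by
  set N := simpleInjectiveAnnihilator A
  have := isSemisimpleModule_quotient_simpleInjectiveAnnihilator (A := A)
  have := IsSimpleModule.nontrivial A U
  obtain ⟨u, hu⟩ := exists_ne (0 : U)
  let p : (A ⧸ N) →ₗ[A] U := N.liftQ (LinearMap.toSpanSingleton A U u) fun a ha ↦ hU a ha u
  have hp : p ≠ 0 := fun h ↦ hu (by
    have h1 : (1 : A) • u = 0 := LinearMap.congr_fun h (N.mkQ 1)
    rwa [one_smul] at h1)
  obtain ⟨s, hs⟩ := IsSemisimpleModule.lifting_property p (LinearMap.surjective_of_ne_zero hp)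
    LinearMap.id
  obtain ⟨b, hb⟩ := N.mkQ_surjective (s u)
  have hbN : b ∉ N := fun h ↦ hu (by
    have h0 : s u = 0 := by rw [← hb]; exact (Submodule.Quotient.mk_eq_zero N).mpr h
    rw [← LinearMap.id_apply (R := A) u, ← hs, LinearMap.comp_apply, h0, map_zero])
  have hex : ∃ (V : Type u) (_ : AddCommGroup V) (_ : Module A V) (_ : IsSimpleModule A V)
      (_ : Module.Injective A V) (v : V), b • v ≠ 0 := by
    by_contra! h
    exact hbN fun V _ _ hs hi v ↦ h V _ _ hs hi v
  obtain ⟨V, _, _, hVs, hVi, v, hv⟩ := hex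
  let r : (A ⧸ N) →ₗ[A] V := N.liftQ (LinearMap.toSpanSingleton A V v)
    fun a ha ↦ ha V hVs hVi v
  have hrs : r ∘ₗ s ≠ 0 := fun h ↦ hv (by
    have := LinearMap.congr_fun h u
    rwa [LinearMap.comp_apply, ← hb] at this)
  let e := LinearEquiv.ofBijective (r ∘ₗ s) (LinearMap.bijective_of_ne_zero hrs)
  exact (Module.Baer.of_equiv e.symm (Module.Baer.of_injective hVi)).injective

/-! ### The central idempotent -/

variable (A) in
/-- `A` is the product of a semisimple ring and a ring that is small as a left module, in terms of
the central idempotent `f` that is the unit of the second factor. -/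
def IsSemisimpleBySmall : Prop :=
  ∃ f : A, IsIdempotentElem f ∧ (∀ a, f * a = a * f) ∧ IsSmallModule A (Ideal.span {f}) ∧
    IsSemisimpleModule A (Ideal.span {1 - f})

/-- When simple injective modules are projective, the annihilator `N` of the simple injective
modules is generated by an idempotent `f`, since `A / N` is projective. The idempotent is central
because cyclic submodules of `N` that are quotients of `A / N` are injective, hence direct summands
of `A` that are killed by `N`. The ideal `N` is superfluous in each injective module containing `A`
because simple quotients of such modules are injective. -/
theorem isSemisimpleBySmall_of_simple_injective_projective
    [IsSemisimpleModule A (A ⧸ Ring.jacobson A)]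
    (hsh : ∀ I : Ideal A, I.FG → Module.Projective A I)
    (h3 : ∀ (U : Type u) [AddCommGroup U] [Module A U],
      IsSimpleModule A U → Module.Injective A U → Module.Projective A U) :
    IsSemisimpleBySmall A := by
  set N := simpleInjectiveAnnihilator A with hNdef
  have hss := isSemisimpleModule_quotient_simpleInjectiveAnnihilator (A := A)
  rw [← hNdef] at hss
  have hNmul : ∀ a ∈ N, ∀ b, a * b ∈ N := fun a ha b ↦ simpleInjectiveAnnihilator_mul_mem ha b
  have hkill : ∀ a ∈ N, ∀ x : A ⧸ N, a • x = 0 := by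
    intro a ha x
    obtain ⟨b, rfl⟩ := N.mkQ_surjective x
    rw [← map_smul]
    exact (Submodule.Quotient.mk_eq_zero N).mpr (hNmul a ha b)
  have hproj : Module.Projective A (A ⧸ N) := projective_of_simple_submodules fun W hW ↦
    h3 W hW (injective_of_simpleInjectiveAnnihilator_smul fun a ha w ↦
      Subtype.ext (hkill a ha w))
  obtain ⟨s, hs⟩ := Module.projective_lifting_property N.mkQ LinearMap.id N.mkQ_surjective
  obtain ⟨f, hf⟩ : ∃ f : A, f = 1 - s (N.mkQ 1) := ⟨_, rfl⟩
  have hfN : f ∈ N := by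
    rw [← Submodule.Quotient.mk_eq_zero, ← Submodule.mkQ_apply, hf, map_sub, sub_eq_zero]
    exact (LinearMap.congr_fun hs (N.mkQ 1)).symm
  have hnf : ∀ n ∈ N, n * f = n := by
    intro n hn
    have h0 : n * s (N.mkQ 1) = 0 := by
      rw [← smul_eq_mul, ← map_smul, hkill n hn, map_zero]
    rw [hf, mul_sub, mul_one, h0, sub_zero]
  have hN : N = Ideal.span {f} := le_antisymm
    (fun n hn ↦ hnf n hn ▸ Ideal.mul_mem_left _ n (Ideal.mem_span_singleton_self f))
    ((Ideal.span_singleton_le_iff_mem N).mpr hfN)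
  have hff : f * f = f := hnf f hfN
  have hfaf : ∀ a, f * a * f = f * a := fun a ↦ hnf _ (hNmul f hfN a)
  have hcentral : ∀ a, f * a = a * f := by
    intro a
    -- since `f * a * f = f * a`, the element `x` is `a * f - f * a`
    set x : A := (1 - f) * a * f with hx
    have hxN : x ∈ N := Ideal.mul_mem_left _ _ hfN
    have hNx : ∀ n ∈ N, n * x = 0 := by
      intro n hn
      rw [← hnf n hn, hx, mul_assoc, ← mul_assoc f, ← mul_assoc f, mul_sub, mul_one, hff,
        sub_self, zero_mul, zero_mul, mul_zero]
    -- the left ideal `A x` is a quotient of `A / N`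
    let p : (A ⧸ N) →ₗ[A] Ideal.span {x} :=
      N.liftQ (LinearMap.toSpanSingleton A _ ⟨x, Ideal.mem_span_singleton_self x⟩)
        fun n hn ↦ Subtype.ext (hNx n hn)
    have hp : Function.Surjective p := by
      rintro ⟨y, hy⟩
      obtain ⟨b, rfl⟩ := Ideal.mem_span_singleton'.mp hy
      exact ⟨N.mkQ b, rfl⟩
    have hAx : IsSemisimpleModule A (Ideal.span {x}) := IsSemisimpleModule.of_surjective p hp
    have hAxfin : Module.Finite A (Ideal.span {x}) := Module.Finite.of_surjective p hp
    have hAxi : Module.Injective A (Ideal.span {x}) := injective_of_simple_submodules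
      fun W hW ↦ injective_of_simpleInjectiveAnnihilator_smul fun n hn w ↦ by
        obtain ⟨b, hb⟩ := Ideal.mem_span_singleton'.mp w.1.2
        apply Subtype.ext
        apply Subtype.ext
        change n * (w.1 : A) = 0
        rw [← hb, ← mul_assoc, hNx _ (hNmul n hn b)]
    -- a retraction of `A` onto `A x` is right multiplication by some `w = b x`
    obtain ⟨r, hr⟩ := hAxi.out (Ideal.span {x}).subtype (Submodule.injective_subtype _)
      LinearMap.id
    have hxw : x * (r 1 : A) = x := by
      have h1 := congrArg Subtype.val (hr ⟨x, Ideal.mem_span_singleton_self x⟩)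
      rw [LinearMap.id_apply, Submodule.subtype_apply] at h1
      rw [← smul_eq_mul, ← Submodule.coe_smul, ← map_smul, smul_eq_mul, mul_one, h1]
    obtain ⟨b, hb⟩ := Ideal.mem_span_singleton'.mp (r 1).2
    have hx0 : x = 0 := by
      rw [← hxw, ← hb, ← mul_assoc, hNx _ (hNmul x hxN b)]
    rw [hx, sub_mul, sub_mul, one_mul, hfaf, sub_eq_zero] at hx0
    exact hx0.symm
  refine ⟨f, hff, hcentral, ?_, ?_⟩
  -- `A f` is superfluous in an injective module containing `A`
  · obtain ⟨E, _, _, i, hE, hi⟩ := exists_injective_embedding (A := A) A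
    refine ⟨E, _, _, i ∘ₗ (Ideal.span {f}).subtype, hi.comp (Submodule.injective_subtype _), ?_⟩
    intro X hX
    by_contra hne
    have hmem : ∀ l : E, ∃ a : A, ∃ x ∈ X, i (a * f) + x = l := by
      intro l
      have hl : l ∈ LinearMap.range (i ∘ₗ (Ideal.span {f}).subtype) ⊔ X :=
        hX ▸ Submodule.mem_top
      obtain ⟨_, ⟨⟨n, hn⟩, rfl⟩, x, hx, hl⟩ := Submodule.mem_sup.mp hl
      obtain ⟨a, rfl⟩ := Ideal.mem_span_singleton'.mp hn
      exact ⟨a, x, hx, hl⟩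
    -- `E / X` is generated by the image of `f`, so it has a simple quotient
    have hfin : Module.Finite A (E ⧸ X) := by
      refine Module.Finite.of_surjective (LinearMap.toSpanSingleton A (E ⧸ X) (X.mkQ (i f))) ?_
      intro y
      obtain ⟨l, rfl⟩ := X.mkQ_surjective y
      obtain ⟨a, x, hx, rfl⟩ := hmem l
      refine ⟨a, ?_⟩
      rw [LinearMap.toSpanSingleton_apply, ← map_smul, ← map_smul, smul_eq_mul, map_add,
        show X.mkQ x = 0 from (Submodule.Quotient.mk_eq_zero X).mpr hx, add_zero]
    have := Submodule.Quotient.nontrivial_iff.mpr hne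
    obtain ⟨Y, hY, -⟩ := (eq_top_or_exists_le_coatom (⊥ : Submodule A (E ⧸ X))).resolve_left
      bot_ne_top
    have hYs := isSimpleModule_iff_isCoatom.mpr hY
    have hYi := injective_of_surjective_of_isSimpleModule hsh hE (Y.mkQ ∘ₗ X.mkQ)
      (Y.mkQ_surjective.comp X.mkQ_surjective)
    have hzero : ∀ l, (Y.mkQ ∘ₗ X.mkQ) l = 0 := by
      intro l
      obtain ⟨a, x, hx, rfl⟩ := hmem l
      rw [map_add, ← mul_one (a * f), ← smul_eq_mul, map_smul, map_smul,
        show (a * f) • (Y.mkQ ∘ₗ X.mkQ) (i 1) = 0 from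
          (Ideal.mul_mem_left N a hfN) _ hYs hYi _, LinearMap.comp_apply,
        show X.mkQ x = 0 from (Submodule.Quotient.mk_eq_zero X).mpr hx, map_zero, add_zero]
    refine hY.1 (top_le_iff.mp fun y _ ↦ ?_)
    obtain ⟨l, rfl⟩ := X.mkQ_surjective y
    exact (Submodule.Quotient.mk_eq_zero Y).mp (hzero l)
  -- `A (1 - f)` embeds in `A / N`
  · refine IsSemisimpleModule.of_injective (N.mkQ ∘ₗ (Ideal.span {1 - f}).subtype)
      ((injective_iff_map_eq_zero _).mpr ?_)
    rintro ⟨y, hy⟩ hy0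
    have hyN : y ∈ N := (Submodule.Quotient.mk_eq_zero N).mp hy0
    obtain ⟨a, rfl⟩ := Ideal.mem_span_singleton'.mp hy
    apply Subtype.ext
    change a * (1 - f) = 0
    rw [← hnf _ hyN, mul_assoc, sub_mul, one_mul, hff, sub_self, mul_zero]

/-- If `f` is a central idempotent and `A (1 - f)` is semisimple, then a module killed by `f` is
injective: in Baer's criterion it suffices to extend from `I ∩ A (1 - f)` to `A (1 - f)`. -/
theorem injective_of_smul_eq_zero {f : A} (hc : ∀ a, f * a = a * f)
    [IsSemisimpleModule A (Ideal.span {1 - f})] {M : Type u} [AddCommGroup M] [Module A M]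
    (hM : ∀ m : M, f • m = 0) : Module.Injective A M := by
  apply Module.Baer.injective
  intro I g
  let K : Ideal A := Ideal.span {1 - f}
  let I' : Submodule A K := Submodule.comap K.subtype I
  let j : I' →ₗ[A] I := (K.subtype ∘ₗ I'.subtype).codRestrict I fun x ↦ x.2
  obtain ⟨h, hh⟩ := IsSemisimpleModule.extension_property I'.subtype I'.injective_subtype (g ∘ₗ j)
  let e : K := ⟨1 - f, Ideal.mem_span_singleton_self _⟩
  refine ⟨LinearMap.toSpanSingleton A M (h e), fun i hi ↦ ?_⟩
  rw [LinearMap.toSpanSingleton_apply, ← map_smul]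
  have hcomm : i * (1 - f) = (1 - f) * i := by rw [mul_sub, sub_mul, hc, mul_one, one_mul]
  have hiI : i • e ∈ I' := by
    change i * (1 - f) ∈ I
    rw [hcomm]
    exact I.mul_mem_left _ hi
  have h1 := LinearMap.congr_fun hh ⟨i • e, hiI⟩
  have h2 : j ⟨i • e, hiI⟩ = (1 - f) • (⟨i, hi⟩ : I) := Subtype.ext hcomm
  rw [LinearMap.comp_apply, LinearMap.comp_apply, h2, map_smul, sub_smul, one_smul, hM,
    sub_zero] at h1
  exact h1

/-! ### The dual Goldie torsion theory -/

theorem IsSmallModule.isDualGoldieTorsion {C : Type u} [AddCommGroup C] [Module A C]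
    (hC : IsSmallModule A C) : IsDualGoldieTorsion A C :=
  fun _ _ _ hN f ↦ hN _ hC f

/-- The torsion submodule of `M` is `f M`, since the torsion-free modules are those killed by
`f`. -/
theorem exists_isCompl_dualGoldieTorsionSubmodule (hA : IsSemisimpleBySmall A) (M : Type u)
    [AddCommGroup M] [Module A M] :
    ∃ K : Submodule A M, IsCompl (dualGoldieTorsionSubmodule A M) K := by
  obtain ⟨f, hff, hc, hsmall, hss⟩ := hA
  have hfree : ∀ (F : Type u) [AddCommGroup F] [Module A F],
      IsDualGoldieTorsionFree A F ↔ ∀ x : F, f • x = 0 := by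
    intro F _ _
    constructor
    · intro hF x
      exact LinearMap.congr_fun
        (hF _ hsmall (LinearMap.toSpanSingleton A F x ∘ₗ (Ideal.span {f}).subtype))
        ⟨f, Ideal.mem_span_singleton_self f⟩
    · intro hF C _ _ hC g
      have hr : Module.Injective A (LinearMap.range g) :=
        injective_of_smul_eq_zero hc fun x ↦ Subtype.ext (hF x)
      have h0 := hC.eq_zero_of_surjective hr g.surjective_rangeRestrict
      ext c
      exact congrArg Subtype.val (LinearMap.congr_fun h0 c)
  let φ : M →ₗ[A] M :=
    { toFun := fun x ↦ f • x
      map_add' := smul_add f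
      map_smul' := fun a x ↦ by rw [RingHom.id_apply, ← mul_smul, hc, mul_smul] }
  have hφφ : ∀ x, φ (φ x) = φ x := fun x ↦ by
    change f • f • x = f • x
    rw [← mul_smul, hff]
  have ht : dualGoldieTorsionSubmodule A M = LinearMap.range φ := by
    apply le_antisymm
    · refine sSup_le fun N hN x hx ↦ ?_
      have hker : IsDualGoldieTorsionFree A (LinearMap.ker φ) :=
        (hfree _).mpr fun y ↦ Subtype.ext y.2
      have h0 := hN _ hker (((LinearMap.id - φ) ∘ₗ N.subtype).codRestrict (LinearMap.ker φ)
        fun y ↦ by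
          rw [LinearMap.mem_ker, LinearMap.comp_apply, LinearMap.sub_apply, map_sub, hφφ,
            LinearMap.id_apply, sub_self])
      exact ⟨x, (sub_eq_zero.mp (congrArg Subtype.val (LinearMap.congr_fun h0 ⟨x, hx⟩))).symm⟩
    · refine le_sSup fun F _ _ hF g ↦ ?_
      ext ⟨_, y, rfl⟩
      have h0 := (hfree F).mp hF (g ⟨φ y, y, rfl⟩)
      rw [← map_smul] at h0
      rw [LinearMap.zero_apply, ← h0]
      exact congrArg g (Subtype.ext (hφφ y).symm)
  refine ⟨LinearMap.ker φ, ?_⟩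
  rw [ht]
  exact LinearMap.IsIdempotentElem.isCompl (LinearMap.ext hφφ)

/-- The torsion submodule of `A` contains the superfluous left ideal `J(A)`, so a complement of it
embeds in `A / J(A)` and is semisimple. Simple injective modules are torsion-free, so they are
quotients of this complement. -/
theorem projective_of_dualGoldie_splits [IsSemisimpleModule A (A ⧸ Ring.jacobson A)]
    {K : Ideal A} (hK : IsCompl (dualGoldieTorsionSubmodule A A) K) {U : Type u}
    [AddCommGroup U] [Module A U] [IsSimpleModule A U] (hU : Module.Injective A U) :
    Module.Projective A U := by
  have hfree : IsDualGoldieTorsionFree A U := fun C _ _ hC g ↦ hC.eq_zero_of_isSimpleModule hU g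
  have hJ : Ring.jacobson A ≤ dualGoldieTorsionSubmodule A A :=
    le_sSup isSmallSubmodule_jacobson.isSmallModule.isDualGoldieTorsion
  have hss : IsSemisimpleModule A K := by
    refine IsSemisimpleModule.of_injective ((Ring.jacobson A).mkQ ∘ₗ K.subtype)
      ((injective_iff_map_eq_zero _).mpr ?_)
    rintro ⟨y, hy⟩ hy0
    have hyJ : y ∈ Ring.jacobson A := (Submodule.Quotient.mk_eq_zero _).mp hy0
    exact Subtype.ext ((Submodule.disjoint_def.mp hK.disjoint) y (hJ hyJ) hy)
  have := IsSimpleModule.nontrivial A U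
  obtain ⟨u, hu⟩ := exists_ne (0 : U)
  have ht : dualGoldieTorsionSubmodule A A ≤ LinearMap.ker (LinearMap.toSpanSingleton A U u) := by
    refine sSup_le fun N hN x hx ↦ ?_
    exact LinearMap.congr_fun (hN U hfree (LinearMap.toSpanSingleton A U u ∘ₗ N.subtype)) ⟨x, hx⟩
  obtain ⟨t, htt, k, hk, htk⟩ := Submodule.mem_sup.mp
    (hK.sup_eq_top ▸ Submodule.mem_top : (1 : A) ∈ dualGoldieTorsionSubmodule A A ⊔ K)
  refine projective_of_semisimple_ideal K hk (u := u) ?_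
  have htu : t • u = 0 := ht htt
  have h1 : (t + k) • u = u := by rw [htk, one_smul]
  rw [add_smul, htu, zero_add] at h1
  rwa [h1]

end LeftModules

/-! ### Change of rings along a surjection -/

section ChangeOfRings

variable {A B : Type u} [Ring A] [Ring B] {φ : A →+* B}

/-- Smallness is inherited by restriction of scalars along a surjection, since the submodules of a
`B`-module are the same over `A` and over `B`. -/
theorem IsSmallModule.of_semilinear_injective (hφ : Function.Surjective φ) {M M' : Type u}
    [AddCommGroup M] [Module A M] [AddCommGroup M'] [Module B M'] (e : M →ₛₗ[φ] M')
    (he : Function.Injective e) (hM' : IsSmallModule B M') : IsSmallModule A M := by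
  obtain ⟨L, _, _, i, hi, hs⟩ := hM'
  let _ : Module A L := Module.compHom L φ
  let j : M →ₗ[A] L :=
    { toFun := fun m ↦ i (e m)
      map_add' := fun x y ↦ by rw [map_add, map_add]
      map_smul' := fun a x ↦ by rw [map_smulₛₗ, map_smul]; rfl }
  refine ⟨L, _, _, j, hi.comp he, fun X hX ↦ ?_⟩
  let X' : Submodule B L :=
    { X.toAddSubmonoid with
      smul_mem' := fun b x hx ↦ by
        obtain ⟨a, rfl⟩ := hφ b
        exact X.smul_mem a hx }
  have h : LinearMap.range i ⊔ X' = ⊤ := by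
    rw [eq_top_iff]
    intro l _
    obtain ⟨_, ⟨m, rfl⟩, x, hx, hl⟩ := Submodule.mem_sup.mp (hX.ge (Submodule.mem_top (x := l)))
    exact Submodule.mem_sup.mpr ⟨i (e m), ⟨e m, rfl⟩, x, hx, hl⟩
  have h' := hs X' h
  exact top_le_iff.mp fun l _ ↦ (h'.ge Submodule.mem_top : l ∈ X')

/-- If `φ : A → B` is the projection of a product of rings onto the factor whose unit is the central
idempotent `f`, then smallness over `A` of a `B`-module gives smallness over `B`: an ambient
`A`-module `L` is replaced by its direct summand `f L`, which is a `B`-module. -/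
theorem IsSmallModule.of_semilinear_bijective (hφ : Function.Surjective φ) {f : A}
    (hff : IsIdempotentElem f) (hc : ∀ a, f * a = a * f) (hker : ∀ a, φ a = 0 → f * a = 0)
    {M M' : Type u} [AddCommGroup M] [Module A M] [AddCommGroup M'] [Module B M']
    (e : M →ₛₗ[φ] M') (he : Function.Bijective e) (hfM : ∀ m : M, f • m = m)
    (hM : IsSmallModule A M) : IsSmallModule B M' := by
  obtain ⟨L, _, _, i, hi, hs⟩ := hM
  let p : L →ₗ[A] L :=
    { toFun := fun x ↦ f • x
      map_add' := smul_add f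
      map_smul' := fun a x ↦ by rw [RingHom.id_apply, ← mul_smul, hc, mul_smul] }
  let F : Submodule A L := LinearMap.range p
  have hfF : ∀ y : F, f • y = y := by
    rintro ⟨_, y, rfl⟩
    apply Subtype.ext
    change f • f • y = f • y
    rw [← mul_smul, hff.eq]
  -- the action of `A` on `F = f L` factors through `φ`
  have hF : RingHom.ker φ ≤ RingHom.ker (Module.toAddMonoidEnd A F) := by
    intro a ha
    refine AddMonoidHom.ext fun y ↦ ?_
    change a • y = 0
    rw [← hfF y, ← mul_smul, ← hc, hker a ha, zero_smul]
  let _ : Module B F := Module.compHom F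
    (φ.liftOfRightInverse (Function.surjInv hφ) (Function.rightInverse_surjInv hφ)
      ⟨Module.toAddMonoidEnd A F, hF⟩)
  have hsmul : ∀ (a : A) (y : F), φ a • y = a • y := fun a y ↦
    DFunLike.congr_fun (RingHom.liftOfRightInverse_comp_apply φ (Function.surjInv hφ)
      (Function.rightInverse_surjInv hφ) ⟨Module.toAddMonoidEnd A F, hF⟩ a) y
  let ε := Equiv.ofBijective e he
  have hε : ∀ m, ε m = e m := fun m ↦ rfl
  let j : M' →ₗ[B] F :=
    { toFun := fun m ↦ p.rangeRestrict (i (ε.symm m))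
      map_add' := fun x y ↦ by
        obtain ⟨x, rfl⟩ := ε.surjective x
        obtain ⟨y, rfl⟩ := ε.surjective y
        rw [hε, hε, ← map_add, ← hε, ← hε, ← hε]
        simp only [Equiv.symm_apply_apply, map_add]
      map_smul' := fun b x ↦ by
        obtain ⟨x, rfl⟩ := ε.surjective x
        obtain ⟨a, rfl⟩ := hφ b
        rw [hε, ← map_smulₛₗ, ← hε, ← hε]
        simp only [Equiv.symm_apply_apply, map_smul, RingHom.id_apply, hsmul] }
  refine ⟨F, _, _, j, ?_, fun X hX ↦ ?_⟩
  · intro x y hxy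
    have h1 : f • i (ε.symm x) = f • i (ε.symm y) := congrArg Subtype.val hxy
    rw [← i.map_smul, ← i.map_smul, hfM, hfM] at h1
    exact ε.symm.injective (hi h1)
  let X' : Submodule A F :=
    { X.toAddSubmonoid with
      smul_mem' := fun a x hx ↦ by
        change a • x ∈ X
        rw [← hsmul]
        exact X.smul_mem _ hx }
  have h : (LinearMap.range i).map p.rangeRestrict ⊔ X' = ⊤ := by
    rw [eq_top_iff]
    intro l _
    obtain ⟨_, ⟨m, rfl⟩, x, hx, hl⟩ := Submodule.mem_sup.mp (hX.ge (Submodule.mem_top (x := l)))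
    exact Submodule.mem_sup.mpr ⟨j m, ⟨i (ε.symm m), ⟨_, rfl⟩, rfl⟩, x, hx, hl⟩
  have h' := hs.map p.rangeRestrict X' h
  exact top_le_iff.mp fun l _ ↦ (h'.ge Submodule.mem_top : l ∈ X')

end ChangeOfRings

/-! ### Right modules as left modules over the opposite ring -/

section Opposite

open MulOpposite

variable {R : Type u} [Ring R]

/-- The ring `R` as a right module is the left regular module of `Rᵐᵒᵖ`. -/
def opSelfLinearEquiv (R : Type u) [Ring R] : R ≃ₗ[Rᵐᵒᵖ] Rᵐᵒᵖ :=
  { opAddEquiv with map_smul' := fun _ _ ↦ rfl }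

/-- The Jacobson radical is left-right symmetric. Here: the elements `1 - x` with `x` in the radical
are units, a symmetric property, and so the radical lies in each maximal right ideal; it is
the whole radical of `Rᵐᵒᵖ` since the quotient is semisimple. -/
theorem IsSemilocal.isSemisimpleModule_op (h : IsSemilocal R) :
    IsSemisimpleModule Rᵐᵒᵖ (Rᵐᵒᵖ ⧸ Ring.jacobson Rᵐᵒᵖ) := by
  have : IsSemisimpleRing (R ⧸ Ring.jacobson R) := h
  let φ : Rᵐᵒᵖ →+* (R ⧸ Ring.jacobson R)ᵐᵒᵖ := RingHom.op (Ideal.Quotient.mk (Ring.jacobson R))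
  have hφ : Function.Surjective φ := by
    intro y
    obtain ⟨r, hr⟩ := Ideal.Quotient.mk_surjective y.unop
    exact ⟨op r, unop_injective hr⟩
  have : RingHomSurjective φ := ⟨hφ⟩
  have hunit : ∀ x ∈ Ring.jacobson R, IsUnit (1 - x) := by
    have hleft : ∀ x ∈ Ring.jacobson R, ∃ s, s * (1 - x) = 1 := by
      intro x hx
      rw [← Ideal.jacobson_bot] at hx
      obtain ⟨s, hs⟩ := Ideal.exists_mul_sub_mem_of_sub_one_mem_jacobson (1 - x)
        (by rw [sub_sub_cancel_left]; exact neg_mem hx)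
      exact ⟨s, sub_eq_zero.mp hs⟩
    intro x hx
    obtain ⟨s, hs⟩ := hleft x hx
    -- `s = 1 - (-s x)` has a left inverse as well
    obtain ⟨t, ht⟩ := hleft (-(s * x)) (neg_mem (Ideal.mul_mem_left _ s hx))
    have hs' : 1 - -(s * x) = s := by
      rw [sub_neg_eq_add, ← hs, mul_sub, mul_one, sub_add_cancel]
    rw [hs'] at ht
    have hts : t = 1 - x := left_inv_eq_right_inv ht hs
    exact ⟨⟨1 - x, s, hts ▸ ht, hs⟩, rfl⟩
  have hker : ∀ a, φ a = 0 → a ∈ Ring.jacobson Rᵐᵒᵖ := by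
    intro a ha
    have ha' : a.unop ∈ Ring.jacobson R :=
      Ideal.Quotient.eq_zero_iff_mem.mp (op_injective ha)
    rw [Ring.jacobson_eq_sInf_isMaximal, Ideal.mem_sInf]
    intro M hM
    by_contra haM
    obtain ⟨b, m, hm, hbm⟩ := hM.exists_inv haM
    have hm' : m = op (1 - a.unop * b.unop) := eq_sub_of_add_eq' hbm
    have hu : IsUnit m := hm' ▸ (hunit _ (Ideal.mul_mem_right b.unop _ ha')).op
    exact hM.ne_top (Ideal.eq_top_of_isUnit_mem _ hm hu)
  have hle : ∀ a ∈ Ring.jacobson Rᵐᵒᵖ, φ a = 0 := by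
    intro a ha
    have h0 := Ring.le_comap_jacobson φ ha
    rwa [IsSemisimpleRing.jacobson_eq_bot (R ⧸ Ring.jacobson R)ᵐᵒᵖ] at h0
  let l : (Rᵐᵒᵖ ⧸ Ring.jacobson Rᵐᵒᵖ) →ₛₗ[φ] (R ⧸ Ring.jacobson R)ᵐᵒᵖ :=
    (Ring.jacobson Rᵐᵒᵖ).liftQ φ.toSemilinearMap hle
  refine (LinearMap.isSemisimpleModule_iff_of_bijective l ⟨?_, ?_⟩).mpr inferInstance
  · refine (injective_iff_map_eq_zero l).mpr fun x hx ↦ ?_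
    obtain ⟨a, rfl⟩ := Submodule.mkQ_surjective _ x
    exact (Submodule.Quotient.mk_eq_zero _).mpr (hker a hx)
  · intro y
    obtain ⟨a, rfl⟩ := hφ y
    exact ⟨Submodule.mkQ _ a, rfl⟩

theorem IsRightSemihereditary.projective_op (h : IsRightSemihereditary R) (I : Ideal Rᵐᵒᵖ)
    (hI : I.FG) : Module.Projective Rᵐᵒᵖ I := by
  let e := (opSelfLinearEquiv R).symm
  have := h (Submodule.map e.toLinearMap I) (Submodule.FG.map _ hI)
  exact Module.Projective.of_equiv (e.submoduleMap I).symm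

/-- A module that is both simple and max-projective is projective: it is some `R / I`, and the
isomorphism to `R / I` lifts to `R`. -/
theorem IsMaxProjective.projective {M : Type u} [AddCommGroup M] [Module Rᵐᵒᵖ M]
    [IsSimpleModule Rᵐᵒᵖ M] (h : IsMaxProjective R M) : Module.Projective Rᵐᵒᵖ M := by
  have := IsSimpleModule.nontrivial Rᵐᵒᵖ M
  obtain ⟨m, hm⟩ := exists_ne (0 : M)
  let p : R →ₗ[Rᵐᵒᵖ] M := LinearMap.toSpanSingleton Rᵐᵒᵖ M m ∘ₗ (opSelfLinearEquiv R).toLinearMap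
  have hp : Function.Surjective p :=
    (IsSimpleModule.toSpanSingleton_surjective Rᵐᵒᵖ hm).comp (opSelfLinearEquiv R).surjective
  let e := p.quotKerEquivOfSurjective hp
  obtain ⟨g, hg⟩ := h (LinearMap.ker p) (LinearMap.isCoatom_ker_of_surjective hp) e.symm.toLinearMap
  have : Module.Projective Rᵐᵒᵖ R := Module.Projective.of_equiv (opSelfLinearEquiv R).symm
  refine Module.Projective.of_split g p (LinearMap.ext fun x ↦ ?_)
  have h1 : (LinearMap.ker p).mkQ (g x) = e.symm x := LinearMap.congr_fun hg x
  have h2 : e ((LinearMap.ker p).mkQ (g x)) = p (g x) := rfl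
  rw [LinearMap.comp_apply, LinearMap.id_apply, ← h2, h1, LinearEquiv.apply_symm_apply]

/-- If the annihilator of some nonzero element is not essential, it is a maximal right ideal with a
nonzero complement, which is isomorphic to the module. -/
theorem isSingular_or_projective_of_isSimpleModule (M : Type u) [AddCommGroup M] [Module Rᵐᵒᵖ M]
    [IsSimpleModule Rᵐᵒᵖ M] : IsSingular R M ∨ Module.Projective Rᵐᵒᵖ M := by
  rw [or_iff_not_imp_right]
  intro hM m
  by_cases hm : m = 0
  · exact ⟨⊤, fun X hX ↦ by rwa [top_inf_eq] at hX, fun r _ ↦ by rw [hm, smul_zero]⟩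
  let p : R →ₗ[Rᵐᵒᵖ] M := LinearMap.toSpanSingleton Rᵐᵒᵖ M m ∘ₗ (opSelfLinearEquiv R).toLinearMap
  have hp : Function.Surjective p :=
    (IsSimpleModule.toSpanSingleton_surjective Rᵐᵒᵖ hm).comp (opSelfLinearEquiv R).surjective
  refine ⟨LinearMap.ker p, fun X hX ↦ ?_, fun r hr ↦ hr⟩
  by_contra hX0
  have hinj : Function.Injective (p ∘ₗ X.subtype) := by
    refine (injective_iff_map_eq_zero _).mpr fun x hx ↦ Subtype.ext ?_
    exact (Submodule.mem_bot _).mp (hX.le ⟨hx, x.2⟩)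
  have hne : p ∘ₗ X.subtype ≠ 0 := fun h0 ↦ hX0 <| (Submodule.eq_bot_iff X).mpr fun x hx ↦
    (Submodule.mem_bot _).mp (hX.le ⟨LinearMap.congr_fun h0 ⟨x, hx⟩, hx⟩)
  let e := LinearEquiv.ofBijective (p ∘ₗ X.subtype) ⟨hinj, LinearMap.surjective_of_ne_zero hne⟩
  have : Module.Projective Rᵐᵒᵖ R := Module.Projective.of_equiv (opSelfLinearEquiv R).symm
  exact hM (Module.Projective.of_split (X.subtype ∘ₗ e.symm.toLinearMap) p
    (LinearMap.ext e.apply_symm_apply))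

/-- The simple quotient `R / I` of an injective module is injective, hence projective, and so the
projection `R → R / I` splits. -/
theorem isRightMaxQF_of_simple_injective_projective (hsl : IsSemilocal R)
    (hsh : IsRightSemihereditary R)
    (h3 : ∀ (M : Type u) [AddCommGroup M] [Module Rᵐᵒᵖ M],
      IsSimpleModule Rᵐᵒᵖ M → Module.Injective Rᵐᵒᵖ M → Module.Projective Rᵐᵒᵖ M) :
    IsRightMaxQF R := by
  intro E _ _ hE I hI f
  have := hsl.isSemisimpleModule_op
  have hs : IsSimpleModule Rᵐᵒᵖ (R ⧸ I) := isSimpleModule_iff_isCoatom.mpr hI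
  by_cases hf : f = 0
  · exact ⟨0, by rw [hf, LinearMap.comp_zero]⟩
  have := h3 (R ⧸ I) hs (injective_of_surjective_of_isSimpleModule hsh.projective_op hE f
    (LinearMap.surjective_of_ne_zero hf))
  obtain ⟨s, hs'⟩ := Module.projective_lifting_property I.mkQ LinearMap.id I.mkQ_surjective
  exact ⟨s ∘ₗ f, by rw [← LinearMap.comp_assoc, hs', LinearMap.id_comp]⟩

/-- A central idempotent `f` of `Rᵐᵒᵖ` decomposes `R` as `R / (f) × R / (1 - f)`. -/
theorem IsSemisimpleBySmall.exists_ringEquiv_prod (h : IsSemisimpleBySmall Rᵐᵒᵖ) :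
    ∃ (S T : Type u) (_ : Ring S) (_ : Ring T),
      IsSemisimpleRing S ∧ IsRightSmall T ∧ Nonempty (R ≃+* S × T) := by
  obtain ⟨f', hff', hc', hsmall, hss⟩ := h
  obtain ⟨f, rfl⟩ := op_surjective f'
  have hff : f * f = f := op_injective hff'
  have hc : ∀ a, f * a = a * f := fun a ↦ (op_injective (hc' (op a))).symm
  have hce : ∀ a, (1 - f) * a = a * (1 - f) := fun a ↦ by
    rw [sub_mul, mul_sub, hc, one_mul, mul_one]
  have hmem : ∀ g : R, g * g = g → ∀ a, a ∈ Ideal.span {g} ↔ a * (1 - g) = 0 := by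
    intro g hg a
    rw [Ideal.mem_span_singleton']
    constructor
    · rintro ⟨b, rfl⟩
      rw [mul_assoc, mul_sub, mul_one, hg, sub_self, mul_zero]
    · intro h
      rw [mul_sub, mul_one, sub_eq_zero] at h
      exact ⟨a, h.symm⟩
  have htwo : ∀ g : R, (∀ a, g * a = a * g) → (Ideal.span {g}).IsTwoSided := fun g hg ↦ ⟨by
    intro a b ha
    obtain ⟨c, rfl⟩ := Ideal.mem_span_singleton'.mp ha
    rw [mul_assoc, hg, ← mul_assoc]
    exact Ideal.mul_mem_left _ _ (Ideal.mem_span_singleton_self g)⟩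
  have := htwo f hc
  have := htwo (1 - f) hce
  have hff1 : (1 - f) * (1 - f) = 1 - f := by
    rw [mul_sub, mul_one, sub_mul, one_mul, hff, sub_self, sub_zero]
  let σ := Ideal.Quotient.mk (Ideal.span {f})
  let τ := Ideal.Quotient.mk (Ideal.span {1 - f})
  have hσ : Function.Surjective σ := Ideal.Quotient.mk_surjective
  have hτ : Function.Surjective τ := Ideal.Quotient.mk_surjective
  have hσ0 : ∀ a, σ a = 0 ↔ a * (1 - f) = 0 := fun a ↦
    Ideal.Quotient.eq_zero_iff_mem.trans (hmem f hff a)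
  have hτ0 : ∀ a, τ a = 0 ↔ a * f = 0 := fun a ↦
    Ideal.Quotient.eq_zero_iff_mem.trans ((hmem _ hff1 a).trans (by rw [sub_sub_cancel]))
  have hσf : σ f = 0 := (hσ0 f).mpr (by rw [mul_sub, mul_one, hff, sub_self])
  have hτf : τ f = 1 := by
    rw [← sub_eq_zero, ← map_one τ, ← map_sub, hτ0, sub_mul, one_mul, hff, sub_self]
  refine ⟨R ⧸ Ideal.span {f}, R ⧸ Ideal.span {1 - f}, inferInstance, inferInstance, ?_, ?_,
    ⟨RingEquiv.ofBijective (σ.prod τ) ⟨?_, ?_⟩⟩⟩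
  · rw [← isSemisimpleRing_mulOpposite_iff]
    have hs : Function.Surjective (RingHom.op σ) := fun y ↦ by
      obtain ⟨r, hr⟩ := hσ y.unop
      exact ⟨op r, unop_injective hr⟩
    have : RingHomSurjective (RingHom.op σ) := ⟨hs⟩
    let l : Ideal.span {1 - op f} →ₛₗ[RingHom.op σ] (R ⧸ Ideal.span {f})ᵐᵒᵖ :=
      (RingHom.op σ).toSemilinearMap.domRestrict _
    refine (LinearMap.isSemisimpleModule_iff_of_bijective l ⟨?_, ?_⟩).mp hss
    · refine (injective_iff_map_eq_zero l).mpr ?_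
      rintro ⟨a, ha⟩ h0
      obtain ⟨b, rfl⟩ := Ideal.mem_span_singleton'.mp ha
      have h1 : (1 - f) * b.unop * (1 - f) = 0 := (hσ0 _).mp (op_injective h0)
      rw [hce, mul_assoc, hff1, ← hce] at h1
      exact Subtype.ext (unop_injective h1)
    · intro y
      obtain ⟨a, rfl⟩ := hs y
      refine ⟨⟨a * (1 - op f), Ideal.mul_mem_left _ _ (Ideal.mem_span_singleton_self _)⟩, ?_⟩
      apply unop_injective
      change σ ((1 - f) * a.unop) = σ a.unop
      rw [map_mul, map_sub, hσf, map_one, sub_zero, one_mul]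
  · have hs : Function.Surjective (RingHom.op τ) := fun y ↦ by
      obtain ⟨r, hr⟩ := hτ y.unop
      exact ⟨op r, unop_injective hr⟩
    let l : Ideal.span {op f} →ₛₗ[RingHom.op τ] R ⧸ Ideal.span {1 - f} :=
      { toFun := fun a ↦ τ a.1.unop
        map_add' := fun a b ↦ map_add τ _ _
        map_smul' := fun a b ↦ map_mul τ _ _ }
    refine IsSmallModule.of_semilinear_bijective hs hff' hc' (fun a ha ↦ ?_) l ⟨?_, ?_⟩ ?_ hsmall
    · exact unop_injective ((hτ0 _).mp (op_injective ha))
    · refine (injective_iff_map_eq_zero l).mpr ?_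
      rintro ⟨a, ha⟩ h0
      obtain ⟨b, rfl⟩ := Ideal.mem_span_singleton'.mp ha
      have h1 : f * b.unop * f = 0 := (hτ0 _).mp h0
      rw [hc, mul_assoc, hff, ← hc] at h1
      exact Subtype.ext (unop_injective h1)
    · intro y
      obtain ⟨a, rfl⟩ := hτ y
      refine ⟨⟨op a * op f, Ideal.mul_mem_left _ _ (Ideal.mem_span_singleton_self _)⟩, ?_⟩
      change τ (f * a) = τ a
      rw [map_mul, hτf, one_mul]
    · rintro ⟨a, ha⟩
      obtain ⟨b, rfl⟩ := Ideal.mem_span_singleton'.mp ha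
      apply Subtype.ext
      change op f * (b * op f) = b * op f
      rw [hc', mul_assoc, hff'.eq]
  · refine (injective_iff_map_eq_zero _).mpr fun a ha ↦ ?_
    have h1 := (hσ0 a).mp (congrArg Prod.fst ha)
    have h2 := (hτ0 a).mp (congrArg Prod.snd ha)
    rwa [mul_sub, mul_one, h2, sub_zero] at h1
  · rintro ⟨x, y⟩
    obtain ⟨a, rfl⟩ := hσ x
    obtain ⟨b, rfl⟩ := hτ y
    refine ⟨a * (1 - f) + b * f, Prod.ext ?_ ?_⟩
    · change σ (a * (1 - f) + b * f) = σ a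
      rw [map_add, map_mul, map_mul, map_sub, hσf, map_one, sub_zero, mul_one, mul_zero, add_zero]
    · change τ (a * (1 - f) + b * f) = τ b
      rw [map_add, map_mul, map_mul, map_sub, hτf, map_one, sub_self, mul_one, mul_zero, zero_add]

theorem isSemisimpleBySmall_of_ringEquiv_prod {S T : Type u} [Ring S] [Ring T]
    [IsSemisimpleRing S] (hT : IsRightSmall T) (ε : R ≃+* S × T) : IsSemisimpleBySmall Rᵐᵒᵖ := by
  let σ : R →+* S := (RingHom.fst S T).comp ε.toRingHom
  let τ : R →+* T := (RingHom.snd S T).comp ε.toRingHom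
  have hext : ∀ a b : R, σ a = σ b → τ a = τ b → a = b := fun a b h h' ↦
    ε.injective (Prod.ext h h')
  have hex : ∀ s t, ∃ a, σ a = s ∧ τ a = t := fun s t ↦ by
    obtain ⟨a, ha⟩ := ε.surjective (s, t)
    exact ⟨a, congrArg Prod.fst ha, congrArg Prod.snd ha⟩
  obtain ⟨f, hσf, hτf⟩ := hex 0 1
  have hσ : Function.Surjective (RingHom.op σ) := fun y ↦ by
    obtain ⟨a, ha, -⟩ := hex y.unop 0
    exact ⟨op a, unop_injective ha⟩
  have hτ : Function.Surjective (RingHom.op τ) := fun y ↦ by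
    obtain ⟨a, -, ha⟩ := hex 0 y.unop
    exact ⟨op a, unop_injective ha⟩
  refine ⟨op f, unop_injective (hext _ _ ?_ ?_), fun a ↦ unop_injective (hext _ _ ?_ ?_), ?_, ?_⟩
  · simp [hσf]
  · simp [hτf]
  · simp [hσf]
  · simp [hτf]
  · let l : Ideal.span {op f} →ₛₗ[RingHom.op τ] T :=
      { toFun := fun a ↦ τ a.1.unop
        map_add' := fun a b ↦ map_add τ _ _
        map_smul' := fun a b ↦ map_mul τ _ _ }
    refine IsSmallModule.of_semilinear_injective hτ l ((injective_iff_map_eq_zero l).mpr ?_) hT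
    rintro ⟨a, ha⟩ h0
    obtain ⟨b, rfl⟩ := Ideal.mem_span_singleton'.mp ha
    refine Subtype.ext (unop_injective (hext _ _ ?_ (h0.trans (map_zero τ).symm)))
    simp [hσf]
  · have : RingHomSurjective (RingHom.op σ) := ⟨hσ⟩
    let l : Ideal.span {1 - op f} →ₛₗ[RingHom.op σ] Sᵐᵒᵖ :=
      (RingHom.op σ).toSemilinearMap.domRestrict _
    refine (LinearMap.isSemisimpleModule_iff_of_bijective l ⟨?_, ?_⟩).mpr inferInstance
    · refine (injective_iff_map_eq_zero l).mpr ?_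
      rintro ⟨a, ha⟩ h0
      obtain ⟨b, rfl⟩ := Ideal.mem_span_singleton'.mp ha
      refine Subtype.ext (unop_injective (hext _ _ ((op_injective h0).trans (map_zero σ).symm) ?_))
      simp [hτf]
    · intro y
      obtain ⟨a, rfl⟩ := hσ y
      refine ⟨⟨a * (1 - op f), Ideal.mul_mem_left _ _ (Ideal.mem_span_singleton_self _)⟩, ?_⟩
      apply unop_injective
      change σ ((1 - f) * a.unop) = σ a.unop
      rw [map_mul, map_sub, hσf, map_one, sub_zero, one_mul]

end Opposite

end MaxQF

theorem mainTheorem2 (R : Type u) [Ring R] (hsl : MaxQF.IsSemilocal R)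
    (hsh : MaxQF.IsRightSemihereditary R) :
    List.TFAE [
      MaxQF.IsRightMaxQF R,
      ∃ (S T : Type u) (_ : Ring S) (_ : Ring T),
        IsSemisimpleRing S ∧ MaxQF.IsRightSmall T ∧ Nonempty (R ≃+* S × T),
      ∀ (M : Type u) [AddCommGroup M] [Module Rᵐᵒᵖ M],
        IsSimpleModule Rᵐᵒᵖ M → Module.Injective Rᵐᵒᵖ M → Module.Projective Rᵐᵒᵖ M,
      ∀ (E : Type u) [AddCommGroup E] [Module Rᵐᵒᵖ E],
        MaxQF.IsSingular R E → Module.Injective Rᵐᵒᵖ E → MaxQF.IsMaxProjective R E,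
      MaxQF.DualGoldieSplits R] := by
  have hss := hsl.isSemisimpleModule_op
  tfae_have 1 → 4 := fun h E _ _ _ hE ↦ h E hE
  tfae_have 4 → 3 := fun h M _ _ _ hi ↦
    (MaxQF.isSingular_or_projective_of_isSimpleModule M).elim (fun hs ↦ (h M hs hi).projective) id
  tfae_have 3 → 1 := MaxQF.isRightMaxQF_of_simple_injective_projective hsl hsh
  tfae_have 3 → 2 := fun h ↦
    (MaxQF.isSemisimpleBySmall_of_simple_injective_projective
      hsh.projective_op h).exists_ringEquiv_prod
  tfae_have 2 → 5 := by
    rintro ⟨S, T, _, _, _, hT, ⟨ε⟩⟩ M _ _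
    exact MaxQF.exists_isCompl_dualGoldieTorsionSubmodule
      (MaxQF.isSemisimpleBySmall_of_ringEquiv_prod hT ε) M
  tfae_have 5 → 3 := fun h M _ _ _ hi ↦
    MaxQF.projective_of_dualGoldie_splits (h Rᵐᵒᵖ).choose_spec hi
  tfae_finish
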